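/- Let $A>1$. There is a constant $c>0$, depending only on $A$, such that the following holds for all integers $d\ge 1$, $M\ge 2$, all real $q>0$ and all integers $n\ge 0$ with $\log M\le 16\,(\min(1,A-1))^2\,n$. Let $\mathcal F(A)$ be the set of all probability densities $f$ on $\mathbb R^d$ (with respect to Lebesgue measure $\lambda$) with $0\le f\le A$. For densities $f,g$ on $\mathbb R^d$ let $P_f=f\,d\lambda$, and let $K(f|g)=\int \log(f/g)\,f\,d\lambda\in[0,\infty]$ if $P_f\ll P_g$ and $K(f|g)=+\infty$ otherwise. An estimator $\hat f_n$ based on a sample of size $n$ assigns to each $(x_1,\dots,x_n)\in(\mathbb R^d)^n$ a density on $\mathbb R^d$, jointly measurably in $(x_1,\dots,x_n)$ and the point of evaluation; $\mathbb E_f$ denotes expectation when the sample consists of $n$ i.i.d. observations of density $f$. Then $$\sup_{f_1,\ldots,f_M\in\mathcal F(A)}\ \inf_{\hat f_n}\ \sup_{f\in\mathcal F(A)}\Big[\mathbb E_f\big[K(f|\hat f_n)^q\big]-\min_{j=1,\ldots,M}K(f|f_j)^q\Big]\ \ge\ c\Big(\frac{\log M}{n}\Big)^q$$ and $$\sup_{f_1,\ldots,f_M\in\mathcal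 F(A)}\ \inf_{\hat f_n}\ \sup_{f\in\mathcal F(A)}\Big[\mathbb E_f\big[K(\hat f_n|f)^q\big]-\min_{j=1,\ldots,M}K(f_j|f)^q\Big]\ \ge\ c\Big(\frac{\log M}{n}\Big)^q .$$ Here the infimum is over all estimators based on a sample of size $n$, all quantities are taken in $[-\infty,+\infty]$, and the difference in brackets is read as $-\infty$ when the minimum is infinite. -/

import Mathlib

open MeasureTheory InformationTheory
open scoped ENNReal

namespace DensityAggregation

/-- `f` is a probability density on `ℝ^d` with respect to Lebesgue measure. -/
structure IsDensity {d : ℕ} (f : EuclideanSpace ℝ (Fin d) → ℝ) : Prop where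
  measurable : Measurable f
  nonneg : ∀ x, 0 ≤ f x
  lintegral_eq_one : ∫⁻ x, ENNReal.ofReal (f x) = 1

/-- The probability distribution `P_f` of density `f` with respect to Lebesgue measure. -/
noncomputable def law {d : ℕ} (f : EuclideanSpace ℝ (Fin d) → ℝ) :
    Measure (EuclideanSpace ℝ (Fin d)) :=
  (volume : Measure (EuclideanSpace ℝ (Fin d))).withDensity fun x => ENNReal.ofReal (f x)

/-- The Kullback-Leibler divergence `K(f|g)`: it is `∫ log (f / g) f` if `P_f ≪ P_g`
(and `∞` if that integral is infinite), and `∞` if `P_f` is not absolutely continuous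
with respect to `P_g`. -/
noncomputable def KL {d : ℕ} (f g : EuclideanSpace ℝ (Fin d) → ℝ) : ℝ≥0∞ :=
  klDiv (law f) (law g)

/-- The set of all densities on `ℝ^d` that are bounded by `A`. -/
def boundedDensities (d : ℕ) (A : ℝ) : Set (EuclideanSpace ℝ (Fin d) → ℝ) :=
  {f | IsDensity f ∧ ∀ x, f x ≤ A}

/-- A density estimator based on a sample of size `n`: a density for every value of the sample,
jointly measurable in the sample and the point of evaluation. -/
structure IsEstimator {d : ℕ} (n : ℕ)
    (fhat : (Fin n → EuclideanSpace ℝ (Fin d)) → EuclideanSpace ℝ (Fin d) → ℝ) : Prop where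
  measurable : Measurable (Function.uncurry fhat)
  isDensity : ∀ D, IsDensity (fhat D)

/-- The set of all density estimators on `ℝ^d` based on a sample of size `n`. -/
def estimators (d n : ℕ) :
    Set ((Fin n → EuclideanSpace ℝ (Fin d)) → EuclideanSpace ℝ (Fin d) → ℝ) :=
  {fhat | IsEstimator n fhat}

/-- The expectation `E_f` of a nonnegative function of a sample of `n` i.i.d. observations
of density `f`. -/
noncomputable def expect {d n : ℕ} (f : EuclideanSpace ℝ (Fin d) → ℝ)
    (Z : (Fin n → EuclideanSpace ℝ (Fin d)) → ℝ≥0∞) : ℝ≥0∞ :=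
  ∫⁻ D, Z D ∂(Measure.pi fun _ : Fin n => law f)

/-- The excess risk `E_f[loss(f, fhat)] - min_j loss(f, f_j)` in the extended reals.
If the minimum is infinite, the difference is `-∞` (in particular `∞ - ∞ = -∞`), so that such
an `f` never contributes to a supremum of excess risks. -/
noncomputable def excessRisk {d n M : ℕ}
    (loss : (EuclideanSpace ℝ (Fin d) → ℝ) → (EuclideanSpace ℝ (Fin d) → ℝ) → ℝ≥0∞)
    (fs : Fin M → EuclideanSpace ℝ (Fin d) → ℝ)
    (fhat : (Fin n → EuclideanSpace ℝ (Fin d)) → EuclideanSpace ℝ (Fin d) → ℝ)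
    (f : EuclideanSpace ℝ (Fin d) → ℝ) : EReal :=
  (expect f (fun D => loss f (fhat D)) : EReal) - ((⨅ j, loss f (fs j) : ℝ≥0∞) : EReal)

/-- The value `sup_{f_1, …, f_M} inf_{fhat} sup_f` of the excess risk, where `f_1, …, f_M` and `f`
range over the densities bounded by `A`, and `fhat` over the estimators based on a sample
of size `n`. -/
noncomputable def minimaxExcess (d n M : ℕ) (A : ℝ)
    (loss : (EuclideanSpace ℝ (Fin d) → ℝ) → (EuclideanSpace ℝ (Fin d) → ℝ) → ℝ≥0∞) : EReal :=
  ⨆ fs : Fin M → boundedDensities d A, ⨅ fhat : estimators d n, ⨆ f : boundedDensities d A,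
    excessRisk loss (fun j => (fs j).1) fhat.1 f.1

end DensityAggregation

/-! All densities used are constant on finitely many disjoint cells of volume one. They are bounded
by 1, hence by `A`, so the resulting constant does not actually depend on `A`.

For `K(f | fhat)`, the truth puts mass `1 - η` on a common cell and `η = 1/(n+1)` on one of `M * B`
other cells. With probability at least 1/3 the whole sample falls in the common cell and reveals
nothing. The estimator must then share its remaining mass among all the cells, so it gives most of
them at most a fraction `1/ρ` of it and pays `η log ρ` (`exists_spike_le_expect`). The `j`-th given
density spreads `η` evenly over the `B` cells of block `j`, so the best of them pays at most `η log
B` (`KL_spike_blockSpike`). For small `q`, `B = 1` suffices. For large `q` that would lose a factor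
exponential in `q`, whereas `B = M ^ 2` and `ρ = M ^ (5/2)` make the ratio of the two losses 5/4,
and its `q`-th power absorbs the probability of failure. This gives a constant uniform in `q`.

For `K(fhat | f)`, the given densities are one base density conditioned on avoiding one of `M`
cells, and the truth is one of them, so nothing is subtracted. Charging the missing cell costs
infinity. An estimator of finite risk must therefore avoid every cell that the sample has not
visited, since any of them might be the missing one. What is left to it has true probability at most
`x = M ^ (-1/n)` on good samples, so it pays at least `-log x = log M / n` there
(`exists_hole_le_expect`). Good samples have probability bounded below (`exists_le_goodSamples`). -/

namespace DensityAggregation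

/-! ### Product measures and a variational bound for the divergence. -/

/-- Products of finite measures are monotone in the factors. -/
theorem pi_measure_mono {ι : Type*} [Fintype ι] {α : ι → Type*} [∀ i, MeasurableSpace (α i)]
    {μ ν : ∀ i, Measure (α i)} [∀ i, SigmaFinite (μ i)] (h : ∀ i, μ i ≤ ν i) :
    Measure.pi μ ≤ Measure.pi ν := by
  -- The product outer measure is the largest one dominated by the product of the factors on boxes,
  -- so it suffices to compare on boxes.
  have key : OuterMeasure.pi (fun i => (μ i).toOuterMeasure) ≤
      OuterMeasure.pi (fun i => (ν i).toOuterMeasure) := by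
    rw [OuterMeasure.le_pi]
    intro s _
    exact (OuterMeasure.pi_pi_le _ s).trans
      (Finset.prod_le_prod' fun i _ => h i (s i))
  refine Measure.le_iff.2 fun s hs => ?_
  rw [Measure.pi_def, Measure.pi_def, toMeasure_apply _ _ hs, toMeasure_apply _ _ hs]
  exact key s

/-- A variational lower bound for the Kullback-Leibler divergence. -/
theorem le_klDiv_of_weight {α : Type*} [MeasurableSpace α] (μ ν : Measure α)
    [IsProbabilityMeasure μ] [IsProbabilityMeasure ν] {r : α → ℝ} (hr0 : ∀ x, 0 ≤ r x)
    (hr : Integrable r ν) (hrμ : ∀ᵐ x ∂μ, 0 < r x)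
    (hlog : Integrable (fun x => Real.log (r x)) μ) :
    ENNReal.ofReal (∫ x, Real.log (r x) ∂μ + 1 - ∫ x, r x ∂ν) ≤ klDiv μ ν := by
  by_cases hac : μ ≪ ν
  swap
  · simp [klDiv_of_not_ac hac]
  by_cases hint : Integrable (llr μ ν) μ
  swap
  · simp [klDiv_of_not_integrable hint]
  rw [klDiv_of_ac_of_integrable hac hint]
  refine ENNReal.ofReal_le_ofReal ?_
  simp only [probReal_univ, add_sub_cancel_right]
  set x : α → ℝ := fun a => (μ.rnDeriv ν a).toReal with hx
  have hmeas : AEStronglyMeasurable (fun a => x a • (r a / x a)) ν := by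
    have h1 : AEStronglyMeasurable x ν :=
      (Measure.measurable_rnDeriv μ ν).ennreal_toReal.aestronglyMeasurable
    exact (h1.aemeasurable.smul (hr.aestronglyMeasurable.aemeasurable.div
      h1.aemeasurable)).aestronglyMeasurable
  -- Only an inequality: where the density `x` vanishes the left side is 0, while `r` may be
  -- positive.
  have hle : ∀ a, x a • (r a / x a) ≤ r a := by
    intro a
    by_cases h : x a = 0
    · simp [h, hr0 a]
    · simp [smul_eq_mul, mul_div_cancel₀, h]
  have hnn : ∀ a, 0 ≤ x a • (r a / x a) := fun a =>
    mul_nonneg ENNReal.toReal_nonneg (div_nonneg (hr0 a) ENNReal.toReal_nonneg)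
  have hint2 : Integrable (fun a => x a • (r a / x a)) ν := by
    refine hr.mono hmeas (Filter.Eventually.of_forall fun a => ?_)
    rw [Real.norm_of_nonneg (hnn a), Real.norm_of_nonneg (hr0 a)]
    exact hle a
  have hint3 : Integrable (fun a => r a / x a) μ := (integrable_rnDeriv_smul_iff hac).1 hint2
  have heq : ∫ a, r a / x a ∂μ ≤ ∫ a, r a ∂ν := by
    rw [← integral_rnDeriv_smul hac]
    exact integral_mono hint2 hr hle
  have hpos : ∀ᵐ a ∂μ, 0 < x a := by
    filter_upwards [Measure.rnDeriv_pos hac, hac.ae_le (Measure.rnDeriv_lt_top μ ν)] with a h1 h2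
    exact ENNReal.toReal_pos h1.ne' h2.ne
  have hsub : Integrable (fun a => 1 - r a / x a) μ := (integrable_const 1).sub hint3
  -- This integrates `log (r / x) ≤ r / x - 1` against `μ`.
  have hmain : ∫ a, (Real.log (r a) + (1 - r a / x a)) ∂μ ≤ ∫ a, llr μ ν a ∂μ := by
    refine integral_mono_ae (hlog.add hsub) hint ?_
    filter_upwards [hpos, hrμ] with a ha hra
    have := Real.log_le_sub_one_of_pos (div_pos hra ha)
    rw [Real.log_div hra.ne' ha.ne'] at this
    simp only [llr]
    change _ ≤ Real.log (x a)
    linarith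
  rw [integral_add hlog hsub,
    integral_sub (integrable_const 1) hint3] at hmain
  simp only [integral_const, probReal_univ, one_smul] at hmain
  linarith

/-- The variational lower bound for a weight that takes two values. -/
theorem le_klDiv_of_two_sets {α : Type*} [MeasurableSpace α] (μ ν : Measure α)
    [IsProbabilityMeasure μ] [IsProbabilityMeasure ν] {S T : Set α} (hS : MeasurableSet S)
    (hT : MeasurableSet T) (hST : Disjoint S T) (hμ : μ.real S + μ.real T = 1) {a b : ℝ}
    (ha : 0 < a) (hb : 0 < b) :
    ENNReal.ofReal (μ.real S * Real.log a + μ.real T * Real.log b + 1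
      - (ν.real S * a + ν.real T * b)) ≤ klDiv μ ν := by
  set r : α → ℝ := fun x => S.indicator (fun _ => a) x + T.indicator (fun _ => b) x with hrdef
  have hlogr : ∀ x, Real.log (r x) =
      S.indicator (fun _ => Real.log a) x + T.indicator (fun _ => Real.log b) x := by
    intro x
    by_cases h1 : x ∈ S
    · have h2 : x ∉ T := Set.disjoint_left.1 hST h1
      simp [hrdef, h1, h2]
    · by_cases h2 : x ∈ T <;> simp [hrdef, h1, h2]
  have hi : ∀ (ρ : Measure α) [IsProbabilityMeasure ρ] {U : Set α} (c : ℝ), MeasurableSet U →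
      Integrable (U.indicator (fun _ => c)) ρ := fun ρ _ U c hU =>
    (integrable_const c).indicator hU
  have hall : ∀ᵐ x ∂μ, x ∈ S ∪ T := by
    rw [← measureReal_union hST hT] at hμ
    have : μ (S ∪ T) = 1 := by
      rw [← ENNReal.toReal_eq_one_iff]; exact hμ
    exact (mem_ae_iff_prob_eq_one (hS.union hT)).2 this
  have key := le_klDiv_of_weight μ ν (r := r) (fun x => by
      by_cases h1 : x ∈ S <;> by_cases h2 : x ∈ T <;> simp [hrdef, h1, h2] <;> positivity)
    ((hi ν a hS).add (hi ν b hT))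
    (by
      filter_upwards [hall] with x hx
      have h1 : 0 ≤ S.indicator (fun _ => a) x := Set.indicator_nonneg (fun _ _ => ha.le) x
      have h2 : 0 ≤ T.indicator (fun _ => b) x := Set.indicator_nonneg (fun _ _ => hb.le) x
      rcases hx with h | h
      · have : S.indicator (fun _ => a) x = a := Set.indicator_of_mem h _
        simp only [hrdef]; linarith
      · have : T.indicator (fun _ => b) x = b := Set.indicator_of_mem h _
        simp only [hrdef]; linarith)
    (by
      simp only [hlogr]
      exact (hi μ _ hS).add (hi μ _ hT))
  refine le_trans (le_of_eq ?_) key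
  congr 2
  · congr 1
    simp only [hlogr]
    rw [integral_add (hi μ _ hS) (hi μ _ hT), integral_indicator_const _ hS,
      integral_indicator_const _ hT, smul_eq_mul, smul_eq_mul]
  · simp only [hrdef]
    rw [integral_add (hi ν _ hS) (hi ν _ hT), integral_indicator_const _ hS,
      integral_indicator_const _ hT, smul_eq_mul, smul_eq_mul]

/-! ### Step densities on disjoint cells of volume one. -/

theorem exists_cells {d : ℕ} (hd : 1 ≤ d) (ι : Type*) [Finite ι] :
    ∃ E : ι → Set (EuclideanSpace ℝ (Fin d)), (∀ i, MeasurableSet (E i)) ∧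
      (∀ i, volume (E i) = 1) ∧ Pairwise (Function.onFun Disjoint E) := by
  obtain ⟨N, ⟨e⟩⟩ := Finite.exists_equiv_fin ι
  let k0 : Fin d := ⟨0, hd⟩
  -- Unit cubes lined up along the first coordinate axis; this is where `1 ≤ d` is needed.
  let lo : ι → Fin d → ℝ := fun i k => if k = k0 then ((e i : ℕ) : ℝ) else 0
  let C : ι → Set (Fin d → ℝ) := fun i => Set.pi Set.univ fun k => Set.Ico (lo i k) (lo i k + 1)
  have hC : ∀ i, MeasurableSet (C i) := fun i =>
    MeasurableSet.pi Set.countable_univ fun k _ => measurableSet_Ico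
  refine ⟨fun i => WithLp.ofLp ⁻¹' C i, fun i => ?_, fun i => ?_, fun i j hij => ?_⟩
  · exact (PiLp.volume_preserving_ofLp (Fin d)).measurable (hC i)
  · rw [(PiLp.volume_preserving_ofLp (Fin d)).measure_preimage (hC i).nullMeasurableSet,
      volume_pi_pi]
    simp
  · refine Set.disjoint_left.2 fun x hx hy => hij ?_
    have h1 := hx k0 (Set.mem_univ _)
    have h2 := hy k0 (Set.mem_univ _)
    simp only [lo, if_true, Set.mem_Ico] at h1 h2
    have h3 : ((e i : ℕ) : ℝ) < (e j : ℕ) + 1 := by linarith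
    have h4 : ((e j : ℕ) : ℝ) < (e i : ℕ) + 1 := by linarith
    norm_cast at h3 h4
    exact e.injective (Fin.ext (by omega))

/-- The function with value `p i` on the cell `E i` and value `0` off the cells. -/
noncomputable def stepDensity {d : ℕ} {ι : Type*} [Fintype ι]
    (E : ι → Set (EuclideanSpace ℝ (Fin d))) (p : ι → ℝ) (x : EuclideanSpace ℝ (Fin d)) : ℝ :=
  ∑ i, (E i).indicator (fun _ => p i) x

/-- A family of pairwise disjoint measurable sets of volume one. -/
structure IsCells {d : ℕ} {ι : Type*} (E : ι → Set (EuclideanSpace ℝ (Fin d))) : Prop where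
  measurableSet : ∀ i, MeasurableSet (E i)
  volume_eq_one : ∀ i, volume (E i) = 1
  pairwise_disjoint : Pairwise (Function.onFun Disjoint E)

section Step

variable {d : ℕ} {ι : Type*} [Fintype ι] {E : ι → Set (EuclideanSpace ℝ (Fin d))}

theorem stepDensity_of_mem (hE : IsCells E) (p : ι → ℝ) {i : ι} {x : EuclideanSpace ℝ (Fin d)}
    (hx : x ∈ E i) : stepDensity E p x = p i := by
  classical
  rw [stepDensity, Finset.sum_eq_single i]
  · simp [hx]
  · intro j _ hj
    exact Set.indicator_of_notMem (Set.disjoint_left.1 (hE.pairwise_disjoint hj.symm) hx) _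
  · simp

theorem stepDensity_of_notMem (p : ι → ℝ) {x : EuclideanSpace ℝ (Fin d)}
    (hx : ∀ i, x ∉ E i) : stepDensity E p x = 0 :=
  Finset.sum_eq_zero fun i _ => Set.indicator_of_notMem (hx i) _

theorem measurable_stepDensity (hE : IsCells E) (p : ι → ℝ) : Measurable (stepDensity E p) :=
  Finset.measurable_sum _ fun i _ => measurable_const.indicator (hE.measurableSet i)

theorem law_stepDensity (hE : IsCells E) {p : ι → ℝ} (hp : ∀ i, 0 ≤ p i) :
    law (stepDensity E p) = ∑ i, ENNReal.ofReal (p i) • volume.restrict (E i) := by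
  have h : (fun x => ENNReal.ofReal (stepDensity E p x)) =
      ∑ i, (E i).indicator (fun _ => ENNReal.ofReal (p i)) := by
    funext x
    rw [stepDensity, ENNReal.ofReal_sum_of_nonneg
      (fun i _ => Set.indicator_nonneg (fun _ _ => hp i) x), Finset.sum_apply]
    refine Finset.sum_congr rfl fun i _ => ?_
    by_cases hx : x ∈ E i <;> simp [hx]
  have h2 : ∀ s : Finset ι, (volume : Measure (EuclideanSpace ℝ (Fin d))).withDensity
      (∑ i ∈ s, (E i).indicator (fun _ => ENNReal.ofReal (p i))) =
      ∑ i ∈ s, ENNReal.ofReal (p i) • volume.restrict (E i) := by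
    classical
    intro s
    induction s using Finset.induction_on with
    | empty => simp
    | insert i s hi ih =>
      rw [Finset.sum_insert hi, Finset.sum_insert hi, withDensity_add_left
        (measurable_const.indicator (hE.measurableSet i)), ih,
        withDensity_indicator (hE.measurableSet i), withDensity_const]
  rw [law, h, h2]

theorem law_stepDensity_apply (hE : IsCells E) {p : ι → ℝ} (hp : ∀ i, 0 ≤ p i)
    {S : Set (EuclideanSpace ℝ (Fin d))} (hS : MeasurableSet S) :
    law (stepDensity E p) S = ∑ i, ENNReal.ofReal (p i) * volume (S ∩ E i) := by
  simp [law_stepDensity hE hp, Measure.restrict_apply hS]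

theorem law_stepDensity_cell (hE : IsCells E) {p : ι → ℝ} (hp : ∀ i, 0 ≤ p i) (i : ι) :
    law (stepDensity E p) (E i) = ENNReal.ofReal (p i) := by
  classical
  rw [law_stepDensity_apply hE hp (hE.measurableSet i), Finset.sum_eq_single i]
  · simp [hE.volume_eq_one]
  · intro j _ hj
    simp [(hE.pairwise_disjoint hj.symm).inter_eq]
  · simp

theorem isDensity_stepDensity (hE : IsCells E) {p : ι → ℝ} (hp : ∀ i, 0 ≤ p i)
    (hsum : ∑ i, p i = 1) : IsDensity (stepDensity E p) where
  measurable := measurable_stepDensity hE p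
  nonneg x := Finset.sum_nonneg fun i _ => Set.indicator_nonneg (fun _ _ => hp i) x
  lintegral_eq_one := by
    have h : law (stepDensity E p) Set.univ = 1 := by
      rw [law_stepDensity_apply hE hp MeasurableSet.univ]
      simp only [Set.univ_inter, hE.volume_eq_one, mul_one]
      rw [← ENNReal.ofReal_sum_of_nonneg fun i _ => hp i, hsum, ENNReal.ofReal_one]
    rwa [law, withDensity_apply _ MeasurableSet.univ, Measure.restrict_univ] at h

theorem stepDensity_mem_boundedDensities (hE : IsCells E) {p : ι → ℝ} (hp : ∀ i, 0 ≤ p i)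
    (hsum : ∑ i, p i = 1) {A : ℝ} (hA : 1 ≤ A) : stepDensity E p ∈ boundedDensities d A := by
  refine ⟨isDensity_stepDensity hE hp hsum, fun x => ?_⟩
  by_cases hx : ∃ i, x ∈ E i
  · obtain ⟨i, hi⟩ := hx
    rw [stepDensity_of_mem hE p hi]
    exact (Finset.single_le_sum (fun j _ => hp j) (Finset.mem_univ i)).trans (hsum.le.trans hA)
  · rw [stepDensity_of_notMem p (not_exists.1 hx)]
    linarith

end Step

/-! ### Laws, divergences of step densities, and reduction of the minimax bound. -/

theorem IsDensity.isProbabilityMeasure {d : ℕ} {f : EuclideanSpace ℝ (Fin d) → ℝ}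
    (hf : IsDensity f) : IsProbabilityMeasure (law f) :=
  ⟨by rw [law, withDensity_apply _ MeasurableSet.univ, Measure.restrict_univ, hf.lintegral_eq_one]⟩

/-- The mass that an estimator gives to a measurable set is a measurable function of the sample. -/
theorem IsEstimator.measurable_law_apply {d n : ℕ}
    {fhat : (Fin n → EuclideanSpace ℝ (Fin d)) → EuclideanSpace ℝ (Fin d) → ℝ}
    (h : IsEstimator n fhat) {S : Set (EuclideanSpace ℝ (Fin d))} (hS : MeasurableSet S) :
    Measurable fun D => law (fhat D) S := by
  simp only [law, withDensity_apply _ hS]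
  exact Measurable.lintegral_prod_right' (f := fun z => ENNReal.ofReal (Function.uncurry fhat z))
    h.measurable.ennreal_ofReal

/-- The divergence between step densities, in terms of the ratios of their cell masses. -/
theorem KL_stepDensity {d : ℕ} {ι : Type*} [Fintype ι]
    {E : ι → Set (EuclideanSpace ℝ (Fin d))} (hE : IsCells E) {p g : ι → ℝ} (hp : ∀ i, 0 ≤ p i)
    (hg : ∀ i, 0 ≤ g i) (hpsum : ∑ i, p i = 1) (hgsum : ∑ i, g i = 1) {ρ : ι → ℝ}
    (hρ : ∀ i, 0 ≤ ρ i) (hpg : ∀ i, p i = ρ i * g i) :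
    KL (stepDensity E p) (stepDensity E g) = ENNReal.ofReal (∑ i, g i * klFun (ρ i)) := by
  have := (isDensity_stepDensity hE hp hpsum).isProbabilityMeasure
  have := (isDensity_stepDensity hE hg hgsum).isProbabilityMeasure
  set r : EuclideanSpace ℝ (Fin d) → ℝ≥0∞ := fun x => ENNReal.ofReal (stepDensity E ρ x)
  have hr : Measurable r := (measurable_stepDensity hE ρ).ennreal_ofReal
  have hlaw : law (stepDensity E p) = (law (stepDensity E g)).withDensity r := by
    rw [law, law, ← withDensity_mul _ (measurable_stepDensity hE g).ennreal_ofReal hr]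
    congr 1
    funext x
    simp only [Pi.mul_apply, r]
    by_cases hx : ∃ i, x ∈ E i
    · obtain ⟨i, hi⟩ := hx
      rw [stepDensity_of_mem hE _ hi, stepDensity_of_mem hE _ hi, stepDensity_of_mem hE _ hi,
        hpg, ENNReal.ofReal_mul (hρ i), mul_comm]
    · simp [stepDensity_of_notMem _ (not_exists.1 hx)]
  rw [KL, klDiv_eq_lintegral_klFun_of_ac (hlaw ▸ withDensity_absolutelyContinuous _ _)]
  have hae := Measure.rnDeriv_withDensity (law (stepDensity E g)) hr
  rw [← hlaw] at hae
  rw [lintegral_congr_ae (g := fun x => ENNReal.ofReal (klFun (r x).toReal))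
    (by filter_upwards [hae] with x hx; rw [hx]), law_stepDensity hE hg,
    lintegral_finsetSum_measure, ENNReal.ofReal_sum_of_nonneg
      fun i _ => mul_nonneg (hg i) (klFun_nonneg (hρ i))]
  refine Finset.sum_congr rfl fun i _ => ?_
  rw [lintegral_smul_measure, setLIntegral_congr_fun (g := fun _ => ENNReal.ofReal (klFun (ρ i)))
    (hE.measurableSet i), setLIntegral_const, hE.volume_eq_one, mul_one, smul_eq_mul,
    ENNReal.ofReal_mul (hg i)]
  intro x hx
  simp only [r, stepDensity_of_mem hE ρ hx, ENNReal.toReal_ofReal (hρ i)]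

theorem le_sub_of_ofReal_le {x y : ℝ} (hx : 0 ≤ x) (hy : 0 ≤ y) {P Q : ℝ≥0∞}
    (hP : ENNReal.ofReal x ≤ P) (hQ : Q ≤ ENNReal.ofReal y) :
    ((x - y : ℝ) : EReal) ≤ (P : EReal) - (Q : EReal) := by
  rw [EReal.coe_sub]
  refine EReal.sub_le_sub ?_ ?_
  · have := EReal.coe_ennreal_le_coe_ennreal_iff.2 hP
    rwa [EReal.coe_ennreal_ofReal, max_eq_left hx] at this
  · have := EReal.coe_ennreal_le_coe_ennreal_iff.2 hQ
    rwa [EReal.coe_ennreal_ofReal, max_eq_left hy] at this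

/-- To bound the minimax excess risk from below it is enough to exhibit the densities `fs`
and, for every estimator, one difficult density. -/
theorem le_minimaxExcess {d n M : ℕ} {A : ℝ}
    {loss : (EuclideanSpace ℝ (Fin d) → ℝ) → (EuclideanSpace ℝ (Fin d) → ℝ) → ℝ≥0∞}
    (fs : Fin M → EuclideanSpace ℝ (Fin d) → ℝ) (hfs : ∀ j, fs j ∈ boundedDensities d A) {v : ℝ}
    (h : ∀ fhat, IsEstimator n fhat → ∃ f ∈ boundedDensities d A, ∃ x y : ℝ, 0 ≤ x ∧ 0 ≤ y ∧
      v ≤ x - y ∧ ENNReal.ofReal x ≤ expect (n := n) f (fun D => loss f (fhat D)) ∧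
      ∃ j, loss f (fs j) ≤ ENNReal.ofReal y) :
    (v : EReal) ≤ minimaxExcess d n M A loss := by
  refine le_iSup_of_le (fun j => ⟨fs j, hfs j⟩) (le_iInf fun fhat => ?_)
  obtain ⟨f, hf, x, y, hx, hy, hv, hP, j, hj⟩ := h fhat.1 fhat.2
  refine le_iSup_of_le ⟨f, hf⟩ ?_
  exact (EReal.coe_le_coe_iff.2 hv).trans
    (le_sub_of_ofReal_le hx hy hP ((iInf_le _ j).trans hj))

/-! ### Lower bound for `K(f | fhat)`: an atypical cell that the sample misses. -/

/-- Markov's inequality for the counting measure: at most `ρ` of the nonnegative numbers `v t` can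
exceed `u / ρ`. It will be applied to the masses that an estimator gives to the cells. -/
theorem card_sub_le_sum_ite {T : Type*} [Fintype T] {v : T → ℝ} (hv : ∀ t, 0 ≤ v t) {u ρ : ℝ}
    (hρ : 0 ≤ ρ) (hu : ∑ t, v t ≤ u) :
    (Fintype.card T : ℝ) - ρ ≤ ∑ t, if ρ * v t ≤ u then (1 : ℝ) else 0 := by
  have hu0 : 0 ≤ u := (Finset.sum_nonneg fun t _ => hv t).trans hu
  rcases hu0.eq_or_lt with h0 | hpos
  · have hz : ∀ t, v t = 0 := fun t =>
      le_antisymm ((Finset.single_le_sum (fun s _ => hv s) (Finset.mem_univ t)).trans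
        (hu.trans h0.ge)) (hv t)
    simp [hz, ← h0, hρ]
  · have h1 : ∀ t, 1 - ρ * v t / u ≤ if ρ * v t ≤ u then (1 : ℝ) else 0 := by
      intro t
      split_ifs with h
      · have : 0 ≤ ρ * v t / u := by have := hv t; positivity
        linarith
      · rw [sub_nonpos, one_le_div hpos]
        linarith
    have h2 := Finset.sum_le_sum fun t (_ : t ∈ Finset.univ) => h1 t
    rw [Finset.sum_sub_distrib, ← Finset.sum_div, ← Finset.mul_sum] at h2
    have h3 : ρ * (∑ t, v t) / u ≤ ρ := by
      rw [div_le_iff₀ hpos]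
      exact mul_le_mul_of_nonneg_left hu hρ
    simp only [Finset.sum_const, Finset.card_univ, nsmul_eq_mul, mul_one] at h2
    linarith

/-- Mass `1 - η` on the common cell `none`, and mass `η` on the cell of `t`. -/
def spike {T : Type*} [DecidableEq T] (η : ℝ) (t : T) : Option T → ℝ
  | none => 1 - η
  | some s => if s = t then η else 0

section Spike

variable {T : Type*} [DecidableEq T]

theorem spike_nonneg {η : ℝ} (h0 : 0 ≤ η) (h1 : η ≤ 1) (t : T) (i : Option T) :
    0 ≤ spike η t i := by
  cases i with
  | none => simpa [spike] using h1
  | some s => simp only [spike]; split_ifs <;> simp [h0]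

variable [Fintype T]

theorem sum_spike (η : ℝ) (t : T) : ∑ i, spike η t i = 1 := by
  simp [Fintype.sum_option, spike]

/-- Whatever the estimator, one of the spike densities is badly estimated, since samples
from the common cell do not tell these densities apart. -/
theorem exists_spike_le_expect {d n : ℕ} [Nonempty T]
    {E : Option T → Set (EuclideanSpace ℝ (Fin d))}
    (hE : IsCells E) {η ρ q : ℝ} (hη0 : 0 ≤ η) (hη1 : η ≤ 1) (hρ : 1 ≤ ρ) (hq : 0 < q)
    {fhat : (Fin n → EuclideanSpace ℝ (Fin d)) → EuclideanSpace ℝ (Fin d) → ℝ}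
    (hf : IsEstimator n fhat) :
    ∃ t : T, ENNReal.ofReal ((1 - η) ^ n * (1 - ρ / Fintype.card T) * (η * Real.log ρ) ^ q) ≤
      expect (stepDensity E (spike η t)) fun D => KL (stepDensity E (spike η t)) (fhat D) ^ q := by
  have hp := fun t : T => spike_nonneg hη0 hη1 t
  have hprob : ∀ D, IsProbabilityMeasure (law (fhat D)) := fun D =>
    (hf.isDensity D).isProbabilityMeasure
  have hprobt : ∀ t : T, IsProbabilityMeasure (law (stepDensity E (spike η t))) := fun t =>
    (isDensity_stepDensity hE (hp t) (sum_spike η t)).isProbabilityMeasure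
  set κ : ℝ := η * Real.log ρ with hκ
  have hκ0 : 0 ≤ κ := mul_nonneg hη0 (Real.log_nonneg hρ)
  -- The part shared by all spike laws, namely their restriction to the common cell. Its `n`-fold
  -- product, of total mass `(1 - η) ^ n`, lies below every sample law, so one measure serves all
  -- `t`.
  set ν0 : Measure (EuclideanSpace ℝ (Fin d)) :=
    ENNReal.ofReal (1 - η) • volume.restrict (E none) with hν0
  have hfin : IsFiniteMeasure ν0 := ⟨by
    simp [hν0, hE.volume_eq_one]⟩
  set ν : Measure (Fin n → EuclideanSpace ℝ (Fin d)) := Measure.pi fun _ => ν0 with hν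
  have hrestr : ∀ t : T, (law (stepDensity E (spike η t))).restrict (E none) = ν0 := by
    intro t
    refine Measure.ext fun S hS => ?_
    rw [Measure.restrict_apply hS, law_stepDensity_apply hE (hp t)
      (hS.inter (hE.measurableSet none)), Finset.sum_eq_single none]
    · simp [hν0, spike, Measure.restrict_apply hS, Set.inter_assoc]
    · intro j _ hj
      rw [Set.inter_assoc, (hE.pairwise_disjoint hj.symm).inter_eq]
      simp
    · simp
  have hνuniv : ν.real Set.univ = (1 - η) ^ n := by
    have h0 : ν Set.univ = ENNReal.ofReal (1 - η) ^ n := by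
      simp [hν, Measure.pi_univ, hν0, hE.volume_eq_one]
    rw [Measure.real, h0, ENNReal.toReal_pow, ENNReal.toReal_ofReal (by linarith)]
  have hexp : ∀ (t : T) (Z : (Fin n → EuclideanSpace ℝ (Fin d)) → ℝ≥0∞),
      ∫⁻ D, Z D ∂ν ≤ expect (stepDensity E (spike η t)) Z := by
    intro t Z
    rw [hν, ← hrestr t, ← Measure.restrict_pi_pi]
    exact setLIntegral_le_lintegral _ _
  -- Samples for which the estimator gives the cell of `t` at most a fraction `1/ρ` of its mass off
  -- the common cell.
  set G : T → Set (Fin n → EuclideanSpace ℝ (Fin d)) := fun t =>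
    {D | ρ * (law (fhat D)).real (E (some t)) ≤ 1 - (law (fhat D)).real (E none)} with hG
  have hGm : ∀ t, MeasurableSet (G t) := fun t => measurableSet_le
    ((hf.measurable_law_apply (hE.measurableSet _)).ennreal_toReal.const_mul ρ)
    (measurable_const.sub (hf.measurable_law_apply (hE.measurableSet _)).ennreal_toReal)
  have hKL : ∀ t, ∀ D ∈ G t,
      ENNReal.ofReal κ ≤ KL (stepDensity E (spike η t)) (fhat D) := by
    intro t D hD
    have hr : ∀ i, (law (stepDensity E (spike η t))).real (E i) = spike η t i := fun i => by
      rw [Measure.real, law_stepDensity_cell hE (hp t), ENNReal.toReal_ofReal (hp t i)]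
    -- The weight is 1 on the common cell and `ρ` on the cell of `t`. On `G t` its integral under
    -- the estimator is at most 1, which leaves `η * log ρ`.
    refine le_trans (ENNReal.ofReal_le_ofReal ?_)
      (le_klDiv_of_two_sets _ _ (hE.measurableSet none) (hE.measurableSet (some t))
        (hE.pairwise_disjoint (by simp)) (by rw [hr, hr]; simp [spike])
        one_pos (lt_of_lt_of_le one_pos hρ))
    rw [hr, hr]
    have hD' : ρ * (law (fhat D)).real (E (some t)) ≤ 1 - (law (fhat D)).real (E none) := hD
    simp only [spike, if_true, Real.log_one, mul_zero, zero_add, mul_one]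
    linarith [mul_comm ρ ((law (fhat D)).real (E (some t)))]
  have hlow : ∀ t, ENNReal.ofReal (κ ^ q) * ν (G t) ≤
      expect (stepDensity E (spike η t)) fun D =>
        KL (stepDensity E (spike η t)) (fhat D) ^ q := by
    intro t
    refine le_trans ?_ (hexp t _)
    rw [← setLIntegral_const]
    refine le_trans (setLIntegral_mono_ae' (hGm t) (Filter.Eventually.of_forall fun D hD => ?_))
      (setLIntegral_le_lintegral _ _)
    rw [← ENNReal.ofReal_rpow_of_nonneg hκ0 hq.le]
    exact ENNReal.rpow_le_rpow (hKL t D hD) hq.le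
  have hcount : ∀ D, (Fintype.card T : ℝ) - ρ ≤ ∑ t, (G t).indicator (fun _ => (1 : ℝ)) D := by
    intro D
    have hsum : ∑ t, (law (fhat D)).real (E (some t)) ≤ 1 - (law (fhat D)).real (E none) := by
      have h1 : ∑ i, (law (fhat D)).real (E i) ≤ 1 := by
        rw [← measureReal_iUnion_fintype hE.pairwise_disjoint hE.measurableSet]
        exact measureReal_le_one
      rw [Fintype.sum_option] at h1
      linarith
    refine (card_sub_le_sum_ite (fun t => measureReal_nonneg) (by linarith) hsum).trans
      (le_of_eq (Finset.sum_congr rfl fun t _ => ?_))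
    by_cases h : D ∈ G t
    · rw [Set.indicator_of_mem h]
      exact if_pos h
    · rw [Set.indicator_of_notMem h]
      exact if_neg h
  have hsumν : ((Fintype.card T : ℝ) - ρ) * (1 - η) ^ n ≤ ∑ t, ν.real (G t) := by
    have hi : ∀ t, Integrable ((G t).indicator fun _ => (1 : ℝ)) ν := fun t =>
      (integrable_const 1).indicator (hGm t)
    have h1 := integral_mono (integrable_const _) (integrable_finsetSum Finset.univ
      fun t _ => hi t) (μ := ν) hcount
    rw [integral_finsetSum _ fun t _ => hi t, integral_const, hνuniv, smul_eq_mul] at h1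
    refine (mul_comm _ _).trans_le (h1.trans (le_of_eq (Finset.sum_congr rfl fun t _ => ?_)))
    rw [integral_indicator_const _ (hGm t), smul_eq_mul, mul_one]
  have hcard : (0 : ℝ) < Fintype.card T := by exact_mod_cast Fintype.card_pos
  -- Pigeonhole: some `G t` has at least the average mass.
  obtain ⟨t, -, ht⟩ := Finset.exists_le_of_sum_le (s := (Finset.univ : Finset T))
    (f := fun _ => (1 - η) ^ n * (1 - ρ / Fintype.card T)) (g := fun t => ν.real (G t))
    Finset.univ_nonempty (by
      refine le_trans (le_of_eq ?_) hsumν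
      rw [Finset.sum_const, Finset.card_univ, nsmul_eq_mul]
      field_simp)
  refine ⟨t, le_trans ?_ (hlow t)⟩
  have hfν : ν (G t) ≠ ∞ := measure_ne_top _ _
  rw [← ENNReal.ofReal_toReal hfν, ← ENNReal.ofReal_mul (Real.rpow_nonneg hκ0 q)]
  refine ENNReal.ofReal_le_ofReal ?_
  rw [mul_comm]
  exact mul_le_mul_of_nonneg_left ht (Real.rpow_nonneg hκ0 q)

end Spike

/-- Mass `1 - η` on the common cell `none`, and mass `η` spread evenly over the cells of `j`. -/
noncomputable def blockSpike {M B : ℕ} (η : ℝ) (j : Fin M) : Option (Fin M × Fin B) → ℝ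
  | none => 1 - η
  | some s => if s.1 = j then η / B else 0

theorem blockSpike_nonneg {M B : ℕ} {η : ℝ} (h0 : 0 ≤ η) (h1 : η ≤ 1) (j : Fin M)
    (i : Option (Fin M × Fin B)) : 0 ≤ blockSpike η j i := by
  cases i with
  | none => simpa [blockSpike] using h1
  | some s =>
    simp only [blockSpike]
    split_ifs
    · positivity
    · exact le_rfl

theorem sum_blockSpike {M B : ℕ} (hB : 0 < B) (η : ℝ) (j : Fin M) :
    ∑ i : Option (Fin M × Fin B), blockSpike η j i = 1 := by
  have : (B : ℝ) ≠ 0 := by positivity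
  have h : ∑ s : Fin M × Fin B, (if s.1 = j then η / B else 0) = η := by
    rw [Fintype.sum_prod_type, Finset.sum_eq_single j]
    · simp only [if_true, Finset.sum_const, Finset.card_univ, Fintype.card_fin, nsmul_eq_mul]
      field_simp
    · intro i _ hi
      simp [hi]
    · simp
  simp only [Fintype.sum_option, blockSpike, h]
  ring

/-- The likelihood ratio is 1 on the common cell, `B` on the cell of `t`, and 0 on the rest of its
block, so only mass `η` contributes, with logarithm `log B`. -/
theorem KL_spike_blockSpike {d M B : ℕ} (hB : 0 < B)
    {E : Option (Fin M × Fin B) → Set (EuclideanSpace ℝ (Fin d))} (hE : IsCells E) {η : ℝ}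
    (h0 : 0 ≤ η) (h1 : η ≤ 1) (t : Fin M × Fin B) :
    KL (stepDensity E (spike η t)) (stepDensity E (blockSpike η t.1)) =
      ENNReal.ofReal (η * Real.log B) := by
  have hB' : (B : ℝ) ≠ 0 := by positivity
  let ρ : Option (Fin M × Fin B) → ℝ := fun i =>
    i.elim 1 fun s => if s = t then (B : ℝ) else 0
  rw [KL_stepDensity hE (ρ := ρ) (spike_nonneg h0 h1 t) (blockSpike_nonneg h0 h1 t.1)
    (sum_spike η t) (sum_blockSpike hB η t.1)]
  · congr 1
    -- Since `klFun 0 = 1`, every cell of the block contributes `η / B`, and the cell of `t` is then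
    -- corrected.
    have hterm : ∀ s : Fin M × Fin B, blockSpike η t.1 (some s) * klFun (ρ (some s)) =
        (if s.1 = t.1 then η / B else 0) +
          (if s = t then η / B * (klFun B - 1) else 0) := by
      intro s
      simp only [blockSpike, ρ, Option.elim]
      by_cases hs : s = t
      · simp only [hs, if_true]; ring
      · by_cases hs1 : s.1 = t.1 <;> simp [hs, hs1, klFun_zero]
    have hsum := sum_blockSpike hB η t.1
    rw [Fintype.sum_option] at hsum ⊢
    simp only [hterm, Finset.sum_add_distrib, Finset.sum_ite_eq', Finset.mem_univ, if_true]
    simp only [blockSpike] at hsum ⊢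
    have h2 : (∑ s : Fin M × Fin B, if s.1 = t.1 then η / B else 0) = η := by linarith
    rw [h2]
    simp only [ρ, Option.elim, klFun_apply, Real.log_one]
    field_simp
    ring
  · intro i
    cases i with
    | none => simp [ρ]
    | some s => simp only [ρ, Option.elim]; split_ifs <;> positivity
  · intro i
    cases i with
    | none => simp [ρ, spike, blockSpike]
    | some s =>
      simp only [ρ, Option.elim, spike, blockSpike]
      by_cases hs : s = t
      · simp only [hs, if_true]; field_simp
      · simp [hs]

/-- The right side is `(1 + 1/n) ^ (-n)`, which is at least `1/e`. -/
theorem one_third_le_pow (n : ℕ) : (1 : ℝ) / 3 ≤ (1 - 1 / ((n : ℝ) + 1)) ^ n := by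
  rcases Nat.eq_zero_or_pos n with rfl | hn
  · norm_num
  have hn' : (0 : ℝ) < n := by exact_mod_cast hn
  have h1 : (1 + 1 / (n : ℝ)) ^ n ≤ 3 := by
    have h2 : (1 + 1 / (n : ℝ)) ≤ Real.exp (1 / n) := by
      linarith [Real.add_one_le_exp (1 / (n : ℝ))]
    calc (1 + 1 / (n : ℝ)) ^ n ≤ Real.exp (1 / n) ^ n := pow_le_pow_left₀ (by positivity) h2 n
      _ = Real.exp 1 := by
        rw [← Real.exp_nat_mul]
        congr 1
        field_simp
      _ ≤ 3 := by linarith [Real.exp_one_lt_d9]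
  have h3 : 1 - 1 / ((n : ℝ) + 1) = (1 + 1 / (n : ℝ))⁻¹ := by
    field_simp
    ring
  rw [h3, inv_pow, one_div]
  exact inv_anti₀ (by positivity) h1

/-- The trade-off with `B` and `ρ` still free. The hypothesis `hρM` says that `ρ` is at most a
fraction `1/√M` of the number of cells, so a fixed proportion of the cells is underestimated. -/
theorem le_minimaxExcess_KL_left_of_le {A : ℝ} (hA : 1 ≤ A) {d M B n : ℕ} (hd : 1 ≤ d)
    (hM : 2 ≤ M) (hB : 0 < B) {q ρ v : ℝ} (hq : 0 < q) (hρ : 1 ≤ ρ)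
    (hρM : ρ * √M ≤ M * B)
    (hv : v ≤ 1 / 11 * (1 / ((n : ℝ) + 1) * Real.log ρ) ^ q -
      (1 / ((n : ℝ) + 1) * Real.log B) ^ q) :
    (v : EReal) ≤ minimaxExcess d n M A fun f g => KL f g ^ q := by
  obtain ⟨E, hE1, hE2, hE3⟩ := exists_cells hd (Option (Fin M × Fin B))
  have hE : IsCells E := ⟨hE1, hE2, hE3⟩
  set η : ℝ := 1 / ((n : ℝ) + 1) with hη
  have hη0 : 0 ≤ η := by positivity
  have hη1 : η ≤ 1 := by
    rw [hη, div_le_one (by positivity)]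
    linarith [(Nat.cast_nonneg n : (0 : ℝ) ≤ n)]
  have hM0 : (0 : ℝ) < M := by positivity
  have hB0 : (0 : ℝ) < B := by positivity
  have hB1 : (1 : ℝ) ≤ B := by exact_mod_cast hB
  have hne : Nonempty (Fin M × Fin B) := ⟨⟨0, by omega⟩, ⟨0, hB⟩⟩
  refine le_minimaxExcess (fun j => stepDensity E (blockSpike η j))
    (fun j => stepDensity_mem_boundedDensities hE (blockSpike_nonneg hη0 hη1 j)
      (sum_blockSpike hB η j) hA) fun fhat hf => ?_
  obtain ⟨t, ht⟩ := exists_spike_le_expect hE hη0 hη1 hρ hq hf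
  have hκ : 0 ≤ η * Real.log ρ := mul_nonneg hη0 (Real.log_nonneg hρ)
  have hb : 0 ≤ η * Real.log B := mul_nonneg hη0 (Real.log_nonneg hB1)
  refine ⟨stepDensity E (spike η t), stepDensity_mem_boundedDensities hE
    (spike_nonneg hη0 hη1 t) (sum_spike η t) hA, 1 / 11 * (η * Real.log ρ) ^ q,
    (η * Real.log B) ^ q, by positivity, by positivity, hv, ?_, t.1, ?_⟩
  · refine le_trans (ENNReal.ofReal_le_ofReal ?_) ht
    refine mul_le_mul_of_nonneg_right ?_ (by positivity)
    have h1 := one_third_le_pow n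
    rw [← hη] at h1
    -- A rational bound below `√2`, fine enough that `1/3 * (1 - 100/141) ≥ 1/11`.
    have hs : (141 / 100 : ℝ) ≤ √M := by
      refine Real.le_sqrt_of_sq_le ?_
      have : (2 : ℝ) ≤ M := by exact_mod_cast hM
      norm_num
      linarith
    have h2 : ρ / (Fintype.card (Fin M × Fin B) : ℝ) ≤ 100 / 141 := by
      rw [Fintype.card_prod, Fintype.card_fin, Fintype.card_fin, Nat.cast_mul,
        div_le_div_iff₀ (by positivity) (by norm_num)]
      nlinarith
    calc (1 : ℝ) / 11 ≤ 1 / 3 * (1 - 100 / 141) := by norm_num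
      _ ≤ _ := by gcongr
  · simp only [KL_spike_blockSpike hB hE hη0 hη1 t]
    rw [ENNReal.ofReal_rpow_of_nonneg hb hq.le]

theorem le_minimaxExcess_KL_left {A : ℝ} (hA : 1 ≤ A) {d M n : ℕ} (hd : 1 ≤ d)
    (hM : 2 ≤ M) (hn : 1 ≤ n) {q : ℝ} (hq : 0 < q) :
    ((1 / 11 * (1 / 4) ^ 14 * (Real.log M / n) ^ q : ℝ) : EReal) ≤
      minimaxExcess d n M A fun f g => KL f g ^ q := by
  have hM1 : (1 : ℝ) ≤ M := by exact_mod_cast (by omega : 1 ≤ M)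
  have hM0 : (0 : ℝ) < M := by linarith
  have hn1 : (1 : ℝ) ≤ n := by exact_mod_cast hn
  have hlog : 0 ≤ Real.log M := Real.log_nonneg hM1
  have hs1 : 1 ≤ √(M : ℝ) := Real.one_le_sqrt.2 hM1
  have hss : √(M : ℝ) * √M = M := Real.mul_self_sqrt hM0.le
  have hlogs : Real.log √(M : ℝ) = Real.log M / 2 := Real.log_sqrt hM0.le
  have hL : 0 ≤ Real.log M / n := by positivity
  have hηn : 1 / (2 * (n : ℝ)) ≤ 1 / ((n : ℝ) + 1) :=
    one_div_le_one_div_of_le (by positivity) (by linarith)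
  -- The exponent 14 is where `(5/4) ^ q` exceeds 22, twice the inverse of the factor 1/11. Below
  -- it, `B = 1` and `ρ = √M` lose only `(1/4) ^ q`, which is at least `(1/4) ^ 14`.
  rcases le_total q 14 with h | h
  · refine le_minimaxExcess_KL_left_of_le hA hd hM one_pos hq hs1 (by simp [hss]) ?_
    simp only [Nat.cast_one, Real.log_one, mul_zero, Real.zero_rpow hq.ne', sub_zero]
    rw [mul_assoc]
    refine mul_le_mul_of_nonneg_left ?_ (by norm_num)
    have h1 : (1 / 4 : ℝ) ^ (14 : ℕ) ≤ (1 / 4) ^ q := by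
      rw [← Real.rpow_natCast]
      exact Real.rpow_le_rpow_of_exponent_ge (by norm_num) (by norm_num) (by exact_mod_cast h)
    calc (1 / 4 : ℝ) ^ 14 * (Real.log M / n) ^ q ≤ (1 / 4) ^ q * (Real.log M / n) ^ q := by
          gcongr
      _ = (1 / (2 * n) * (Real.log M / 2)) ^ q := by
        rw [← Real.mul_rpow (by norm_num) hL]
        congr 1
        field_simp
        ring
      _ ≤ _ := by
        rw [hlogs]
        gcongr
  -- With `B = M ^ 2`, the gain `1/11 * (5/4) ^ q * z ^ q ≥ 2 * z ^ q` beats the subtracted `z ^ q`,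
  -- and `z ≥ log M / n`.
  · have hρ : (1 : ℝ) ≤ M ^ 2 * √M := by nlinarith [one_le_pow₀ hM1 (n := 2)]
    refine le_minimaxExcess_KL_left_of_le hA hd hM (B := M ^ 2) (by positivity) hq hρ
      (by rw [mul_assoc, hss]; push_cast; exact (mul_comm _ _).le) ?_
    set z : ℝ := 1 / ((n : ℝ) + 1) * Real.log ((M ^ 2 : ℕ) : ℝ) with hz
    have hz' : z = 1 / ((n : ℝ) + 1) * (2 * Real.log M) := by
      rw [hz]
      push_cast
      rw [Real.log_pow]
      norm_num
    have hz0 : 0 ≤ z := by rw [hz']; positivity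
    have hlogρ : 1 / ((n : ℝ) + 1) * Real.log (M ^ 2 * √M) = 5 / 4 * z := by
      rw [Real.log_mul (by positivity) (by positivity), hlogs, Real.log_pow, hz']
      push_cast
      ring
    rw [hlogρ, Real.mul_rpow (by norm_num) hz0]
    have h1 : (22 : ℝ) ≤ (5 / 4) ^ q := by
      calc (22 : ℝ) ≤ (5 / 4) ^ (14 : ℕ) := by norm_num
        _ = (5 / 4) ^ ((14 : ℕ) : ℝ) := (Real.rpow_natCast _ _).symm
        _ ≤ _ := Real.rpow_le_rpow_of_exponent_le (by norm_num) (by exact_mod_cast h)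
    have h2 : (Real.log M / n) ^ q ≤ z ^ q := by
      refine Real.rpow_le_rpow hL ?_ hq.le
      rw [hz']
      calc Real.log M / n = 1 / (2 * n) * (2 * Real.log M) := by field_simp
        _ ≤ _ := by gcongr
    have h3 : 0 ≤ z ^ q := by positivity
    have h4 : 0 ≤ (Real.log M / n) ^ q := by positivity
    nlinarith [mul_le_mul_of_nonneg_right h1 h3]

/-! ### Lower bound for `K(fhat | f)`: densities with a hole. -/

/-- Mass `x ^ 2` on the cell `none`, the rest being spread evenly over the other cells. -/
noncomputable def baseMass {M : ℕ} (x : ℝ) : Option (Fin M) → ℝ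
  | none => x ^ 2
  | some _ => (1 - x ^ 2) / M

/-- The masses `baseMass`, conditioned on avoiding the cell of `j`. -/
noncomputable def holeMass {M : ℕ} (x : ℝ) (j : Fin M) (i : Option (Fin M)) : ℝ :=
  if i = some j then 0 else baseMass x i / (1 - (1 - x ^ 2) / M)

section Hole

variable {d M n : ℕ} {x : ℝ}

theorem baseMass_nonneg (hx0 : 0 < x) (hx1 : x < 1) (i : Option (Fin M)) : 0 ≤ baseMass x i := by
  have : 0 ≤ 1 - x ^ 2 := by nlinarith
  cases i <;> simp only [baseMass] <;> positivity

theorem sum_baseMass (hM : 2 ≤ M) (x : ℝ) : ∑ i : Option (Fin M), baseMass x i = 1 := by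
  have : (M : ℝ) ≠ 0 := by positivity
  simp only [Fintype.sum_option, baseMass, Finset.sum_const, Finset.card_univ, Fintype.card_fin,
    nsmul_eq_mul]
  field_simp
  ring

theorem cellMass_lt (hM : 2 ≤ M) (hx0 : 0 < x) (hx1 : x < 1) : (1 - x ^ 2) / M < 1 - x := by
  have hM' : (2 : ℝ) ≤ M := by exact_mod_cast hM
  rw [div_lt_iff₀ (by linarith)]
  nlinarith

theorem one_sub_cellMass_pos (hM : 2 ≤ M) (hx0 : 0 < x) (hx1 : x < 1) :
    0 < 1 - (1 - x ^ 2) / M := by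
  linarith [cellMass_lt hM hx0 hx1]

theorem holeMass_nonneg (hM : 2 ≤ M) (hx0 : 0 < x) (hx1 : x < 1) (j : Fin M)
    (i : Option (Fin M)) : 0 ≤ holeMass x j i := by
  rw [holeMass]
  split_ifs
  · exact le_rfl
  · exact div_nonneg (baseMass_nonneg hx0 hx1 i) (one_sub_cellMass_pos hM hx0 hx1).le

theorem sum_holeMass (hM : 2 ≤ M) (hx0 : 0 < x) (hx1 : x < 1) (j : Fin M) :
    ∑ i, holeMass x j i = 1 := by
  have h := one_sub_cellMass_pos hM hx0 hx1
  have h1 : ∀ i, holeMass x j i = baseMass x i / (1 - (1 - x ^ 2) / M) -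
      if i = some j then (1 - x ^ 2) / M / (1 - (1 - x ^ 2) / M) else 0 := by
    intro i
    rw [holeMass]
    split_ifs with hi
    · simp [hi, baseMass]
    · simp
  simp only [h1, Finset.sum_sub_distrib, Finset.sum_ite_eq', Finset.mem_univ, if_true,
    ← Finset.sum_div, sum_baseMass hM x]
  rw [← sub_div, div_self h.ne']

variable {E : Option (Fin M) → Set (EuclideanSpace ℝ (Fin d))}

/-- Conditioning divides by a number at most 1, so it only increases the mass off the hole. This
allows all the hole densities to be compared with the one base law. -/
theorem restrict_baseMass_le_holeMass (hE : IsCells E) (hM : 2 ≤ M) (hx0 : 0 < x) (hx1 : x < 1)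
    (j : Fin M) : (law (stepDensity E (baseMass x))).restrict (E (some j))ᶜ ≤
      law (stepDensity E (holeMass x j)) := by
  refine Measure.le_iff.2 fun S hS => ?_
  have hc := (hE.measurableSet (some j)).compl
  rw [Measure.restrict_apply hS, law_stepDensity_apply hE (baseMass_nonneg hx0 hx1) (hS.inter hc),
    law_stepDensity_apply hE (holeMass_nonneg hM hx0 hx1 j) hS]
  refine Finset.sum_le_sum fun i _ => ?_
  by_cases hi : i = some j
  · rw [hi, Set.inter_assoc, Set.compl_inter_self]
    simp
  · refine mul_le_mul' (ENNReal.ofReal_le_ofReal ?_) (measure_mono fun y hy => ⟨hy.1.1, hy.2⟩)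
    rw [holeMass, if_neg hi]
    refine le_div_self (baseMass_nonneg hx0 hx1 i) (one_sub_cellMass_pos hM hx0 hx1) ?_
    have : 0 ≤ (1 - x ^ 2) / (M : ℝ) := baseMass_nonneg hx0 hx1 (some j)
    linarith

/-- The samples that avoid the cell of `j` and have few points outside of the cell `none`. -/
def goodSamples (n : ℕ) (E : Option (Fin M) → Set (EuclideanSpace ℝ (Fin d))) (x : ℝ)
    (j : Fin M) : Set (Fin n → EuclideanSpace ℝ (Fin d)) :=
  (Set.univ.pi fun _ => (E (some j))ᶜ) ∩
    {D | x ^ 2 + (1 - x ^ 2) / M * ∑ i, (E none)ᶜ.indicator (fun _ => (1 : ℝ)) (D i) ≤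
      x * (1 - (1 - x ^ 2) / M)}

theorem measurableSet_goodSamples (hE : IsCells E) (j : Fin M) :
    MeasurableSet (goodSamples n E x j) := by
  refine (MeasurableSet.univ_pi fun _ => (hE.measurableSet _).compl).inter
    (measurableSet_le ?_ measurable_const)
  refine measurable_const.add (Measurable.const_mul (Finset.measurable_sum _ fun i _ => ?_) _)
  exact (measurable_const.indicator (hE.measurableSet _).compl).comp (measurable_pi_apply i)

/-- The union of the cells that a sample does not visit. -/
def unseen (E : Option (Fin M) → Set (EuclideanSpace ℝ (Fin d)))
    (D : Fin n → EuclideanSpace ℝ (Fin d)) : Set (EuclideanSpace ℝ (Fin d)) :=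
  ⋃ k : {k : Fin M // ∀ i, D i ∉ E (some k)}, E (some k)

theorem measurableSet_unseen (hE : IsCells E) (D : Fin n → EuclideanSpace ℝ (Fin d)) :
    MeasurableSet (unseen E D) :=
  MeasurableSet.iUnion fun _ => hE.measurableSet _

open Classical in
theorem sum_seen_le (hE : IsCells E) (D : Fin n → EuclideanSpace ℝ (Fin d)) :
    ∑ k : Fin M, (if ∃ i, D i ∈ E (some k) then (1 : ℝ) else 0) ≤
      ∑ i, (E none)ᶜ.indicator (fun _ => (1 : ℝ)) (D i) := by
  have hnn : ∀ (k : Fin M) y, 0 ≤ (E (some k)).indicator (fun _ => (1 : ℝ)) y := fun k y =>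
    Set.indicator_nonneg (fun _ _ => zero_le_one) y
  calc ∑ k : Fin M, (if ∃ i, D i ∈ E (some k) then (1 : ℝ) else 0)
      ≤ ∑ k : Fin M, ∑ i, (E (some k)).indicator (fun _ => (1 : ℝ)) (D i) := by
        refine Finset.sum_le_sum fun k _ => ?_
        split_ifs with h
        · obtain ⟨i, hi⟩ := h
          refine le_trans (le_of_eq ?_) (Finset.single_le_sum (fun i _ => hnn k (D i))
            (Finset.mem_univ i))
          rw [Set.indicator_of_mem hi]
        · exact Finset.sum_nonneg fun i _ => hnn k _
    _ = ∑ i, ∑ k : Fin M, (E (some k)).indicator (fun _ => (1 : ℝ)) (D i) := Finset.sum_comm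
    _ ≤ _ := by
        refine Finset.sum_le_sum fun i _ => ?_
        by_cases h : ∃ k : Fin M, D i ∈ E (some k)
        · obtain ⟨k, hk⟩ := h
          rw [Finset.sum_eq_single k]
          · rw [Set.indicator_of_mem hk, Set.indicator_of_mem]
            exact Set.disjoint_left.1 (hE.pairwise_disjoint (by simp)) hk
          · intro l _ hl
            exact Set.indicator_of_notMem
              (Set.disjoint_left.1 (hE.pairwise_disjoint (by simpa using hl.symm)) hk) _
          · simp
        · rw [Finset.sum_eq_zero fun k _ => Set.indicator_of_notMem (not_exists.1 h k) _]
          exact Set.indicator_nonneg (fun _ _ => zero_le_one) _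

/-- Up to a null set, the complement of `unseen E D` consists of the cell `none` and the visited
cells. The visited cells are at most as many as the sample points off `none`, and the inequality
defining `goodSamples` bounds the resulting conditioned mass by `x`. -/
theorem law_holeMass_compl_unseen_le (hE : IsCells E) (hM : 2 ≤ M) (hx0 : 0 < x) (hx1 : x < 1)
    (j : Fin M) {D : Fin n → EuclideanSpace ℝ (Fin d)} (hD : D ∈ goodSamples n E x j) :
    (law (stepDensity E (holeMass x j))).real (unseen E D)ᶜ ≤ x := by
  classical
  have hw : 0 ≤ (1 - x ^ 2) / (M : ℝ) := baseMass_nonneg hx0 hx1 (some j)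
  have hw1 := one_sub_cellMass_pos hM hx0 hx1
  have hn := holeMass_nonneg hM hx0 hx1 j
  set q : Option (Fin M) → ℝ := fun i =>
    i.elim (x ^ 2) fun k => (1 - x ^ 2) / M * if ∃ i, D i ∈ E (some k) then (1 : ℝ) else 0
  have hq : ∀ i, 0 ≤ q i := by
    intro i
    cases i with
    | none => simp only [q, Option.elim]; positivity
    | some k => simp only [q, Option.elim]; split_ifs <;> simp [hw]
  have hle : law (stepDensity E (holeMass x j)) (unseen E D)ᶜ ≤
      ENNReal.ofReal (∑ i, q i / (1 - (1 - x ^ 2) / M)) := by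
    rw [law_stepDensity_apply hE hn (measurableSet_unseen hE D).compl,
      ENNReal.ofReal_sum_of_nonneg fun i _ => div_nonneg (hq i) hw1.le]
    refine Finset.sum_le_sum fun i _ => ?_
    have hvol : volume ((unseen E D)ᶜ ∩ E i) ≤ 1 :=
      (measure_mono Set.inter_subset_right).trans (hE.volume_eq_one i).le
    have hhole : holeMass x j i ≤ baseMass x i / (1 - (1 - x ^ 2) / M) := by
      rw [holeMass]
      split_ifs
      · exact div_nonneg (baseMass_nonneg hx0 hx1 i) hw1.le
      · exact le_rfl
    -- This can fail only on an unvisited cell, which lies inside `unseen E D` and contributes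
    -- nothing.
    by_cases hi : baseMass x i ≤ q i
    · refine (mul_le_of_le_one_right' hvol).trans (ENNReal.ofReal_le_ofReal (hhole.trans ?_))
      gcongr
    · cases i with
      | none => exact absurd le_rfl hi
      | some k =>
        have hk : ¬ ∃ i, D i ∈ E (some k) := fun h => hi (by simp [q, h, baseMass])
        have hsub : E (some k) ⊆ unseen E D :=
          Set.subset_iUnion (fun k : {k : Fin M // ∀ i, D i ∉ E (some k)} => E (some k.1))
            ⟨k, not_exists.1 hk⟩
        rw [Set.disjoint_iff_inter_eq_empty.1 (Set.disjoint_compl_left_iff_subset.2 hsub)]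
        simp
  have hsum : ∑ i, q i / (1 - (1 - x ^ 2) / M) ≤ x := by
    rw [← Finset.sum_div, div_le_iff₀ hw1, Fintype.sum_option]
    simp only [q, Option.elim]
    rw [← Finset.mul_sum]
    refine le_trans ?_ hD.2
    gcongr
    exact sum_seen_le hE D
  exact (ENNReal.toReal_mono ENNReal.ofReal_ne_top hle).trans
    ((ENNReal.toReal_ofReal (Finset.sum_nonneg fun i _ => div_nonneg (hq i) hw1.le)).trans_le hsum)

/-- Whatever the estimator, its divergence from one of the densities with a hole is large:
an estimator that is at risk of charging the hole has infinite risk, and one that is not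
has to keep off all the cells that the sample does not visit. -/
theorem exists_hole_le_expect (hE : IsCells E) (hM : 2 ≤ M) (hx0 : 0 < x) (hx1 : x < 1)
    (j : Fin M) {q : ℝ} (hq : 0 < q)
    {fhat : (Fin n → EuclideanSpace ℝ (Fin d)) → EuclideanSpace ℝ (Fin d) → ℝ}
    (hf : IsEstimator n fhat) :
    ∃ k, ENNReal.ofReal ((-Real.log x) ^ q *
        (Measure.pi fun _ : Fin n => law (stepDensity E (baseMass x))).real
          (goodSamples n E x j)) ≤
      expect (stepDensity E (holeMass x k)) fun D =>
        KL (fhat D) (stepDensity E (holeMass x k)) ^ q := by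
  have hprob : ∀ D, IsProbabilityMeasure (law (fhat D)) := fun D =>
    (hf.isDensity D).isProbabilityMeasure
  have hprobk : ∀ k : Fin M, IsProbabilityMeasure (law (stepDensity E (holeMass x k))) := fun k =>
    (isDensity_stepDensity hE (holeMass_nonneg hM hx0 hx1 k)
      (sum_holeMass hM hx0 hx1 k)).isProbabilityMeasure
  have hprobb : IsProbabilityMeasure (law (stepDensity E (baseMass (M := M) x))) :=
    (isDensity_stepDensity hE (baseMass_nonneg hx0 hx1) (sum_baseMass hM x)).isProbabilityMeasure
  set H : Measure (Fin n → EuclideanSpace ℝ (Fin d)) :=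
    Measure.pi fun _ => law (stepDensity E (baseMass x)) with hH
  set P : Fin M → Measure (Fin n → EuclideanSpace ℝ (Fin d)) := fun k =>
    Measure.pi fun _ => law (stepDensity E (holeMass x k)) with hP
  have hHP : ∀ k, H.restrict (Set.univ.pi fun _ => (E (some k))ᶜ) ≤ P k := by
    intro k
    rw [hH, Measure.restrict_pi_pi]
    exact pi_measure_mono fun _ => restrict_baseMass_le_holeMass hE hM hx0 hx1 k
  set V : Fin M → Set (Fin n → EuclideanSpace ℝ (Fin d)) := fun k =>
    {D | law (fhat D) (E (some k)) ≠ 0} with hV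
  have hVm : ∀ k, MeasurableSet (V k) := fun k =>
    (hf.measurable_law_apply (hE.measurableSet _)) (measurableSet_singleton 0).compl
  -- If the estimator charges the hole of `k` with positive probability under `P k`, absolute
  -- continuity fails there and its risk is infinite.
  by_cases hcase : ∃ k, P k (V k) ≠ 0
  · obtain ⟨k, hk⟩ := hcase
    refine ⟨k, le_top.trans ?_⟩
    have h1 : ∫⁻ _ in V k, ∞ ∂P k = ∞ := by
      rw [setLIntegral_const, ENNReal.top_mul hk]
    rw [← h1]
    refine le_trans (setLIntegral_mono_ae' (hVm k) (Filter.Eventually.of_forall fun D hD => ?_))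
      (setLIntegral_le_lintegral _ _)
    rw [KL, klDiv_of_not_ac, ENNReal.top_rpow_of_pos hq]
    intro hac
    refine hD (hac ?_)
    rw [law_stepDensity_cell hE (holeMass_nonneg hM hx0 hx1 k)]
    simp [holeMass]
  · push Not at hcase
    refine ⟨j, ?_⟩
    -- `V k` is null for `P k`, hence for `H` restricted to samples avoiding the cell of `k`. As
    -- this holds for every `k`, under `H` the estimator avoids all unvisited cells at once.
    have hae : ∀ᵐ D ∂H, ∀ k, (∀ i, D i ∉ E (some k)) → law (fhat D) (E (some k)) = 0 := by
      refine ae_all_iff.2 fun k => ?_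
      have h1 : H.restrict (Set.univ.pi fun _ => (E (some k))ᶜ) (V k) = 0 :=
        le_antisymm ((hHP k (V k)).trans (hcase k).le) zero_le
      rw [Measure.restrict_apply (hVm k)] at h1
      filter_upwards [measure_eq_zero_iff_ae_notMem.1 h1] with D hD hav
      by_contra hne
      exact hD ⟨hne, fun i _ => hav i⟩
    have hlog : 0 ≤ -Real.log x := by linarith [Real.log_nonpos hx0.le hx1.le]
    have hbound : ENNReal.ofReal ((-Real.log x) ^ q) * H (goodSamples n E x j) ≤
        ∫⁻ D, KL (fhat D) (stepDensity E (holeMass x j)) ^ q ∂P j := by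
      rw [← setLIntegral_const]
      refine le_trans ?_ (lintegral_mono' (hHP j) le_rfl)
      refine le_trans (setLIntegral_mono_ae' (measurableSet_goodSamples hE j) ?_)
        (lintegral_mono_set Set.inter_subset_left)
      filter_upwards [hae] with D hD hgood
      rw [← ENNReal.ofReal_rpow_of_nonneg hlog hq.le]
      refine ENNReal.rpow_le_rpow ?_ hq.le
      have hzero : law (fhat D) (unseen E D) = 0 :=
        measure_iUnion_null fun k => hD k.1 k.2
      have hone : (law (fhat D)).real (unseen E D)ᶜ = 1 := by
        rw [probReal_compl_eq_one_sub (measurableSet_unseen hE D), Measure.real, hzero]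
        simp
      -- The weight is `1/x` on the complement of `unseen E D`, which carries the whole estimator
      -- but at most `x` of the true mass.
      refine le_trans (ENNReal.ofReal_le_ofReal ?_) (le_klDiv_of_two_sets _ _
        (measurableSet_unseen hE D).compl MeasurableSet.empty (Set.disjoint_empty _)
        (by rw [hone]; simp) (inv_pos.2 hx0) one_pos)
      have h2 := law_holeMass_compl_unseen_le hE hM hx0 hx1 j hgood
      have h3 : (law (stepDensity E (holeMass x j))).real (unseen E D)ᶜ * x⁻¹ ≤ 1 := by
        rw [← div_eq_mul_inv, div_le_one hx0]
        exact h2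
      rw [hone, Real.log_inv]
      simp only [one_mul, measureReal_empty, zero_mul, add_zero]
      linarith
    refine le_trans (le_of_eq ?_) hbound
    rw [ENNReal.ofReal_mul (Real.rpow_nonneg hlog q), ofReal_measureReal]

end Hole

/-! ### Probability of the good samples under the base law. -/

section GoodSamples

variable {d M n : ℕ} {x : ℝ} {E : Option (Fin M) → Set (EuclideanSpace ℝ (Fin d))}

/-- Samples lying entirely in the cell `none` are good. This crude bound serves for bounded `M`. -/
theorem pow_le_goodSamples (hE : IsCells E) (hM : 2 ≤ M) (hx0 : 0 < x) (hx1 : x < 1)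
    (j : Fin M) : (x ^ 2) ^ n ≤ (Measure.pi fun _ : Fin n => law (stepDensity E (baseMass x))).real
      (goodSamples n E x j) := by
  have hprobb : IsProbabilityMeasure (law (stepDensity E (baseMass (M := M) x))) :=
    (isDensity_stepDensity hE (baseMass_nonneg hx0 hx1) (sum_baseMass hM x)).isProbabilityMeasure
  have h1 : (Measure.pi fun _ : Fin n => law (stepDensity E (baseMass x))).real
      (Set.univ.pi fun _ => E none) = (x ^ 2) ^ n := by
    rw [Measure.real, Measure.pi_pi]
    simp only [law_stepDensity_cell hE (baseMass_nonneg hx0 hx1), baseMass]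
    rw [Finset.prod_const, Finset.card_univ, Fintype.card_fin, ENNReal.toReal_pow,
      ENNReal.toReal_ofReal (by positivity)]
  rw [← h1]
  refine measureReal_mono fun D hD => ⟨fun i _ => ?_, ?_⟩
  · exact Set.disjoint_left.1 (hE.pairwise_disjoint (by simp)) (hD i (Set.mem_univ _))
  · have h2 : ∀ i, (E none)ᶜ.indicator (fun _ => (1 : ℝ)) (D i) = 0 := fun i =>
      Set.indicator_of_notMem (Set.notMem_compl_iff.2 (hD i (Set.mem_univ _))) _
    simp only [Set.mem_ofPred_eq, h2, Finset.sum_const_zero, mul_zero, add_zero]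
    nlinarith [cellMass_lt hM hx0 hx1]

/-- A bad sample either hits the cell of `j` or has at least `x * M / 4` points off `none`. A union
bound handles the first event and Markov's inequality the second; the 5 is `4 + 1`. -/
theorem one_sub_le_goodSamples (hE : IsCells E) (hM : 4 ≤ M) (hx0 : 0 < x) (hx1 : x < 1)
    (j : Fin M) : 1 - n * (1 - x ^ 2) * (5 / (x * M)) ≤
      (Measure.pi fun _ : Fin n => law (stepDensity E (baseMass x))).real
        (goodSamples n E x j) := by
  have hprobb : IsProbabilityMeasure (law (stepDensity E (baseMass (M := M) x))) :=
    (isDensity_stepDensity hE (baseMass_nonneg hx0 hx1)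
      (sum_baseMass (by omega) x)).isProbabilityMeasure
  set H0 := law (stepDensity E (baseMass (M := M) x)) with hH0
  set H := Measure.pi fun _ : Fin n => H0 with hH
  have hcell : ∀ i, H0.real (E i) = baseMass x i := fun i => by
    rw [Measure.real, hH0, law_stepDensity_cell hE (baseMass_nonneg hx0 hx1),
      ENNReal.toReal_ofReal (baseMass_nonneg hx0 hx1 i)]
  have hM' : (4 : ℝ) ≤ M := by exact_mod_cast hM
  have hM0 : (0 : ℝ) < M := by linarith
  have hη : 0 < 1 - x ^ 2 := by nlinarith
  set g : EuclideanSpace ℝ (Fin d) → ℝ := (E none)ᶜ.indicator fun _ => (1 : ℝ) with hg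
  have hgm : MeasurableSet (E none)ᶜ := (hE.measurableSet _).compl
  have hgi : Integrable g H0 := (integrable_const 1).indicator hgm
  have hg0 : ∀ y, 0 ≤ g y := fun y => Set.indicator_nonneg (fun _ _ => zero_le_one) y
  have hgint : ∫ y, g y ∂H0 = 1 - x ^ 2 := by
    rw [hg, integral_indicator_const _ hgm, smul_eq_mul, mul_one,
      probReal_compl_eq_one_sub (hE.measurableSet _), hcell]
    rfl
  have hgiD : ∀ i : Fin n, Integrable (fun D : Fin n → EuclideanSpace ℝ (Fin d) => g (D i)) H :=
    fun i => integrable_comp_eval (μ := fun _ : Fin n => H0) hgi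
  have hsum : ∫ D, ∑ i, g (D i) ∂H = n * (1 - x ^ 2) := by
    rw [integral_finsetSum _ fun i _ => hgiD i]
    have h1 : ∀ i : Fin n, ∫ D, g (D i) ∂H = 1 - x ^ 2 := fun i =>
      (integral_comp_eval (μ := fun _ : Fin n => H0) hgi.aestronglyMeasurable).trans hgint
    simp only [h1, Finset.sum_const, Finset.card_univ, Fintype.card_fin, nsmul_eq_mul]
  -- At this threshold the visited cells cost `x * (1 - x ^ 2) / 4`. For `M ≥ 4` the term from the
  -- hole costs no more, and together they fit into `x - x ^ 2`.
  set s : ℝ := x * M / 4 with hs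
  have hs0 : 0 < s := by positivity
  have hmarkov : H.real {D | s ≤ ∑ i, g (D i)} ≤ n * (1 - x ^ 2) / s := by
    rw [le_div_iff₀ hs0, mul_comm, ← hsum]
    exact mul_meas_ge_le_integral_of_nonneg
      (Filter.Eventually.of_forall fun D => Finset.sum_nonneg fun i _ => hg0 (D i))
      (integrable_finsetSum _ fun i _ => hgiD i) s
  have hhit : H.real (⋃ i : Fin n, {D | D i ∈ E (some j)}) ≤ n * ((1 - x ^ 2) / M) := by
    refine (measureReal_iUnion_fintype_le _).trans (le_of_eq ?_)
    have h1 : ∀ i : Fin n, H.real {D | D i ∈ E (some j)} = (1 - x ^ 2) / M := fun i => by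
      have := (measurePreserving_eval (fun _ : Fin n => H0) i).measure_preimage
        (hE.measurableSet (some j)).nullMeasurableSet
      exact (congrArg ENNReal.toReal this).trans (hcell (some j))
    simp [h1]
  have hcompl : (goodSamples n E x j)ᶜ ⊆
      {D | s ≤ ∑ i, g (D i)} ∪ ⋃ i : Fin n, {D | D i ∈ E (some j)} := by
    intro D hD
    by_contra hcon
    rw [Set.mem_union, not_or] at hcon
    refine hD ⟨fun i _ hi => hcon.2 (Set.mem_iUnion.2 ⟨i, hi⟩), ?_⟩
    have h1 : ∑ i, g (D i) ≤ s := (not_le.1 hcon.1).le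
    have h2 : (1 - x ^ 2) / M * ∑ i, g (D i) ≤ (1 - x ^ 2) / M * s :=
      mul_le_mul_of_nonneg_left h1 (by positivity)
    have h3 : (1 - x ^ 2) / M * s = x * (1 - x ^ 2) / 4 := by
      rw [hs]
      field_simp
    have h4 : (1 - x ^ 2) / M ≤ (1 - x ^ 2) / 4 := by gcongr
    have h5 : x * ((1 - x ^ 2) / M) ≤ x * ((1 - x ^ 2) / 4) :=
      mul_le_mul_of_nonneg_left h4 hx0.le
    have h6 : x * (1 - x ^ 2) / 2 ≤ x * (1 - x) := by
      nlinarith [mul_pos hx0 (sub_pos.2 hx1), mul_pos (mul_pos hx0 (sub_pos.2 hx1)) (sub_pos.2 hx1)]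
    change x ^ 2 + (1 - x ^ 2) / M * ∑ i, g (D i) ≤ x * (1 - (1 - x ^ 2) / M)
    linarith
  have htot : H.real (goodSamples n E x j)ᶜ ≤ n * (1 - x ^ 2) / s + n * ((1 - x ^ 2) / M) :=
    (measureReal_mono hcompl).trans ((measureReal_union_le _ _).trans (add_le_add hmarkov hhit))
  rw [probReal_compl_eq_one_sub (measurableSet_goodSamples hE j)] at htot
  have h7 : n * (1 - x ^ 2) / s + n * ((1 - x ^ 2) / M) ≤ n * (1 - x ^ 2) * (5 / (x * M)) := by
    have h8 : (1 : ℝ) / M ≤ 1 / (x * M) :=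
      one_div_le_one_div_of_le (by positivity) (by nlinarith)
    have h9 := mul_le_mul_of_nonneg_left h8 (by positivity : 0 ≤ n * (1 - x ^ 2))
    calc n * (1 - x ^ 2) / s + n * ((1 - x ^ 2) / M)
        = n * (1 - x ^ 2) * (4 / (x * M)) + n * (1 - x ^ 2) * (1 / M) := by
          rw [hs]
          field_simp
      _ ≤ n * (1 - x ^ 2) * (4 / (x * M)) + n * (1 - x ^ 2) * (1 / (x * M)) := by gcongr
      _ = _ := by ring
  linarith

end GoodSamples

/-- Here `x = M ^ (-1/n)`. For small `M` the bound `x ^ (2 * n) = M ^ (-2)` is enough. For large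
`M`, about `2 * log M` points at most are expected off `none`, and `x ≥ exp (-16)`, so the failure
probability is of order `log M / M`. -/
theorem exists_le_goodSamples : ∃ c : ℝ, 0 < c ∧ ∀ {d M n : ℕ}
    {E : Option (Fin M) → Set (EuclideanSpace ℝ (Fin d))}, IsCells E → 2 ≤ M → 1 ≤ n →
    Real.log M ≤ 16 * n → ∀ j : Fin M,
    c ≤ (Measure.pi fun _ : Fin n => law (stepDensity E
      (baseMass (Real.exp (-(Real.log M / n)))))).real
        (goodSamples n E (Real.exp (-(Real.log M / n))) j) := by
  -- The 20 makes the failure probability at most `2 * 5 / 20 = 1/2`.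
  have hev : ∀ᶠ M : ℕ in Filter.atTop, Real.log M ≤ Real.exp (-16) / 20 * M := by
    have h1 := (Real.isLittleO_log_id_atTop.def
      (by positivity : 0 < Real.exp (-16) / 20))
    filter_upwards [(tendsto_natCast_atTop_atTop (R := ℝ)).eventually h1] with M hM
    have h2 := (le_abs_self _).trans hM
    simpa using h2
  obtain ⟨N, hN⟩ := Filter.eventually_atTop.1 hev
  set M0 : ℕ := max N 4 with hM0
  have hM0' : (4 : ℝ) ≤ M0 := by exact_mod_cast le_max_right N 4
  refine ⟨((M0 : ℝ) ^ 2)⁻¹, by positivity, fun {d M n E} hE hM hn hlog j => ?_⟩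
  have hMr : (2 : ℝ) ≤ M := by exact_mod_cast hM
  have hnr : (1 : ℝ) ≤ n := by exact_mod_cast hn
  have hMpos : (0 : ℝ) < M := by linarith
  have hL : 0 < Real.log M / n := div_pos (Real.log_pos (by linarith)) (by linarith)
  set x : ℝ := Real.exp (-(Real.log M / n)) with hx
  have hx0 : 0 < x := Real.exp_pos _
  have hx1 : x < 1 := by
    rw [hx, Real.exp_lt_one_iff]
    linarith
  rcases lt_or_ge M M0 with hlt | hge
  · refine le_trans ?_ (pow_le_goodSamples hE hM hx0 hx1 j)
    have h1 : x ^ n = (M : ℝ)⁻¹ := by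
      rw [hx, ← Real.exp_nat_mul, ← Real.exp_log hMpos, ← Real.exp_neg, Real.exp_log hMpos]
      congr 1
      field_simp
    rw [← pow_mul, mul_comm, pow_mul, h1, inv_pow]
    have h2 : (M : ℝ) ≤ M0 := by exact_mod_cast hlt.le
    gcongr
  · refine le_trans ?_ (one_sub_le_goodSamples hE ((le_max_right N 4).trans hge) hx0 hx1 j)
    have h1 : 1 - x ^ 2 ≤ 2 * (Real.log M / n) := by
      have h2 : x ^ 2 = Real.exp (-(2 * (Real.log M / n))) := by
        rw [hx, ← Real.exp_nat_mul]
        congr 1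
        push_cast
        ring
      linarith [Real.add_one_le_exp (-(2 * (Real.log M / n)))]
    have h2 : n * (1 - x ^ 2) ≤ 2 * Real.log M := by
      calc n * (1 - x ^ 2) ≤ n * (2 * (Real.log M / n)) := by gcongr
        _ = 2 * Real.log M := by field_simp
    have h3 : Real.exp (-16) ≤ x := by
      refine Real.exp_le_exp.2 (neg_le_neg ?_)
      rw [div_le_iff₀ (by linarith)]
      exact hlog
    have h4 : n * (1 - x ^ 2) * (5 / (x * M)) ≤ 1 / 2 := by
      have h5 : Real.log M ≤ x / 20 * M :=
        (hN M ((le_max_left N 4).trans hge)).trans (by gcongr)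
      calc n * (1 - x ^ 2) * (5 / (x * M)) ≤ 2 * (x / 20 * M) * (5 / (x * M)) := by
            exact mul_le_mul_of_nonneg_right (by linarith) (by positivity)
        _ = 1 / 2 := by
          field_simp
          norm_num
    have h6 : ((M0 : ℝ) ^ 2)⁻¹ ≤ 1 / 2 := by
      rw [one_div]
      exact inv_anti₀ (by norm_num) (by nlinarith)
    linarith

theorem exists_le_minimaxExcess_KL_right : ∃ c : ℝ, 0 < c ∧ ∀ {A : ℝ}, 1 ≤ A → ∀ {d M n : ℕ},
    1 ≤ d → 2 ≤ M → 1 ≤ n → Real.log M ≤ 16 * n → ∀ {q : ℝ}, 0 < q →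
      ((c * (Real.log M / n) ^ q : ℝ) : EReal) ≤
        minimaxExcess d n M A fun f g => KL g f ^ q := by
  obtain ⟨c, hc, h⟩ := exists_le_goodSamples
  refine ⟨c, hc, fun {A} hA {d M n} hd hM hn hlog {q} hq => ?_⟩
  obtain ⟨E, hE1, hE2, hE3⟩ := exists_cells hd (Option (Fin M))
  have hE : IsCells E := ⟨hE1, hE2, hE3⟩
  have hMr : (2 : ℝ) ≤ M := by exact_mod_cast hM
  have hnr : (1 : ℝ) ≤ n := by exact_mod_cast hn
  have hL : 0 < Real.log M / n := div_pos (Real.log_pos (by linarith)) (by linarith)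
  set x : ℝ := Real.exp (-(Real.log M / n)) with hx
  have hx0 : 0 < x := Real.exp_pos _
  have hx1 : x < 1 := by
    rw [hx, Real.exp_lt_one_iff]
    linarith
  have hmem : ∀ k : Fin M, stepDensity E (holeMass x k) ∈ boundedDensities d A := fun k =>
    stepDensity_mem_boundedDensities hE (holeMass_nonneg hM hx0 hx1 k)
      (sum_holeMass hM hx0 hx1 k) hA
  refine le_minimaxExcess (fun k => stepDensity E (holeMass x k)) hmem fun fhat hf => ?_
  -- Any index will do, since the bound on good samples is the same for all of them.
  let j : Fin M := ⟨0, by omega⟩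
  obtain ⟨k, hk⟩ := exists_hole_le_expect hE hM hx0 hx1 j hq hf
  refine ⟨_, hmem k, c * (Real.log M / n) ^ q, 0, by positivity, le_rfl, (sub_zero _).ge, ?_, k, ?_⟩
  · refine le_trans (ENNReal.ofReal_le_ofReal ?_) hk
    have h1 : -Real.log x = Real.log M / n := by rw [hx, Real.log_exp, neg_neg]
    rw [h1, mul_comm]
    exact mul_le_mul_of_nonneg_left (h hE hM hn hlog j) (by positivity)
  · have := (hmem k).1.isProbabilityMeasure
    simp [KL, klDiv_self, ENNReal.zero_rpow_of_pos hq]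

end DensityAggregation

/-! ### Combination of the two bounds. -/

theorem mainTheorem3 (A : ℝ) (hA : 1 < A) :
    ∃ c : ℝ, 0 < c ∧
      ∀ (d : ℕ), 1 ≤ d → ∀ (M : ℕ), 2 ≤ M → ∀ (q : ℝ), 0 < q →
        ∀ (n : ℕ), Real.log (M : ℝ) ≤ 16 * (min 1 (A - 1)) ^ 2 * (n : ℝ) →
          ((c * (Real.log (M : ℝ) / (n : ℝ)) ^ q : ℝ) : EReal) ≤
              DensityAggregation.minimaxExcess d n M A
                (fun f g => DensityAggregation.KL f g ^ q) ∧
          ((c * (Real.log (M : ℝ) / (n : ℝ)) ^ q : ℝ) : EReal) ≤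
              DensityAggregation.minimaxExcess d n M A
                (fun f g => DensityAggregation.KL g f ^ q) := by
  obtain ⟨c, hc, h⟩ := DensityAggregation.exists_le_minimaxExcess_KL_right
  refine ⟨min (1 / 11 * (1 / 4) ^ 14) c, lt_min (by norm_num) hc, fun d hd M hM q hq n hn => ?_⟩
  have hMr : (2 : ℝ) ≤ M := by exact_mod_cast hM
  have hlog : 0 < Real.log M := Real.log_pos (by linarith)
  -- For `n = 0` the hypothesis would give `log M ≤ 0`, contradicting `M ≥ 2`.
  have hn1 : 1 ≤ n := by
    by_contra hn0
    have : n = 0 := by omega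
    simp only [this, Nat.cast_zero, mul_zero] at hn
    linarith
  have hlog16 : Real.log M ≤ 16 * n := by
    have h1 : (min 1 (A - 1)) ^ 2 ≤ 1 :=
      pow_le_one₀ (le_min zero_le_one (by linarith)) (min_le_left _ _)
    refine hn.trans ?_
    gcongr
    linarith
  have hpow : 0 ≤ (Real.log M / n) ^ q := by positivity
  refine ⟨le_trans (EReal.coe_le_coe_iff.2 (mul_le_mul_of_nonneg_right (min_le_left _ _) hpow))
      (DensityAggregation.le_minimaxExcess_KL_left hA.le hd hM hn1 hq),
    le_trans (EReal.coe_le_coe_iff.2 (mul_le_mul_of_nonneg_right (min_le_right _ _) hpow))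
      (h hA.le hd hM hn1 hlog16 hq)⟩
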